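/- Theorem 3.2. There is an absolute constant $c>0$ such that the following holds for all integers $N,w$ with $0<w$ and $2w\le N$, and every integer $T \ge 0$. Let $Q$ be a quantum algorithm that makes $T$ queries to a pair of membership oracles $A_0,A_1\subseteq[N]=\{1,\dots,N\}$: starting from a fixed unit vector in the space with orthonormal basis $|b,i\rangle|z\rangle|s\rangle$ ($b,z\in\{0,1\}$, $i\in[N]$, $s$ in an arbitrary finite workspace), it applies $T$ times the query $|b,i\rangle|z\rangle|s\rangle\mapsto|b,i\rangle|z\oplus[i\in A_b]\rangle|s\rangle$ followed by a unitary that may depend on the step but not on the oracles, then measures in this basis and accepts if the outcome lies in a fixed set. Suppose that $Q$ is an $\mathsf{SBQP}$ algorithm for $\mathsf{AND}_2\circ\mathsf{ApxCount}_{N,w}$, that is, there is a real number $\alpha>0$ such that - $\Pr[Q^{A_0,A_1}\text{ accepts}]\ge 2\alpha$ whenever $|A_0|\ge 2w$ and $|A_1|\ge 2w$ (yes-instances), and - $\Pr[Q^{A_0,A_1}\text{ accepts}]\le\alpha$ whenever each of $|A_0|,|A_1|$ is either at most $w$ or at least $2w$, and at least one of them is at most $w$ (no-instances). Then $T\ge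 c\cdot\min\{\sqrt w,\sqrt{N/w}\}$. -/

import Mathlib

namespace QuantumQuery

/-- Computational basis states of a quantum algorithm with two membership oracles on `[N]`
(modelled as `Fin N`). A basis state `((b, i), z, s)` consists of a query register, whose
bit `b` selects one of the two oracles and whose second part `i` is an element of `[N]`,
an answer bit `z`, and a state `s` of the workspace `W`. -/
abbrev BasisState (N : ℕ) (W : Type*) : Type _ := (Bool × Fin N) × Bool × W

/-- The action of one query on basis states:
`|b, i⟩|z⟩|s⟩ ↦ |b, i⟩|z ⊕ [i ∈ A_b]⟩|s⟩`. -/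
def queryMap {N : ℕ} {W : Type*} (A : Bool → Finset (Fin N)) (x : BasisState N W) :
    BasisState N W :=
  (x.1, xor x.2.1 (decide (x.1.2 ∈ A x.1.1)), x.2.2)

/-- A query is self-inverse on basis states. -/
theorem queryMap_involutive {N : ℕ} {W : Type*} (A : Bool → Finset (Fin N)) :
    Function.Involutive (queryMap (W := W) A) := by
  rintro ⟨⟨b, i⟩, z, s⟩
  by_cases h : i ∈ A b <;> simp [queryMap, h]

/-- The query unitary: the linear extension of `queryMap A` to amplitude vectors. As `queryMap A`
is its own inverse, the amplitude of `x` after the query is that of `queryMap A x` before it. -/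
def applyQuery {N : ℕ} {W : Type*} (A : Bool → Finset (Fin N)) (ψ : BasisState N W → ℂ) :
    BasisState N W → ℂ :=
  fun x => ψ (queryMap A x)

/-- A quantum algorithm making `T` queries to a pair of membership oracles on `[N]`, with
workspace `W` (an arbitrary finite set of basis states): a unit starting vector, an
oracle-independent unitary to be applied after each of the `T` queries, and the set of
measurement outcomes on which the algorithm accepts. (The unitary that is commonly applied
before the first query is absorbed in the starting vector, which is arbitrary.) -/
structure QueryAlgorithm (N T : ℕ) (W : Type*) [Fintype W] [DecidableEq W] where
  /-- the state before the first query -/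
  start : BasisState N W → ℂ
  /-- the starting state is normalized -/
  start_unit : ∑ x, ‖start x‖ ^ 2 = 1
  /-- the unitary applied after each query -/
  unitary : Fin T → Matrix.unitaryGroup (BasisState N W) ℂ
  /-- the accepting measurement outcomes -/
  accept : Finset (BasisState N W)

namespace QueryAlgorithm

variable {N T : ℕ} {W : Type*} [Fintype W] [DecidableEq W]

/-- The final state `U_T O_A U_{T-1} O_A ⋯ U_1 O_A |start⟩` with oracles `A false`, `A true`. -/
def finalState (Q : QueryAlgorithm N T W) (A : Bool → Finset (Fin N)) : BasisState N W → ℂ :=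
  Fin.foldl T
    (fun ψ t => Matrix.mulVec (Q.unitary t : Matrix (BasisState N W) (BasisState N W) ℂ)
      (applyQuery A ψ))
    Q.start

/-- The probability that measuring the final state in the computational basis gives an
accepting outcome. -/
noncomputable def acceptProb (Q : QueryAlgorithm N T W) (A : Bool → Finset (Fin N)) : ℝ :=
  ∑ x ∈ Q.accept, ‖Q.finalState A x‖ ^ 2

end QueryAlgorithm

/-- Yes-instances of approximate counting: sets of size at least `2w`. -/
def ApxCountYes {N : ℕ} (w : ℕ) (A : Finset (Fin N)) : Prop := 2 * w ≤ A.card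

/-- No-instances of approximate counting: sets of size at most `w`. -/
def ApxCountNo {N : ℕ} (w : ℕ) (A : Finset (Fin N)) : Prop := A.card ≤ w

/-- Yes-instances of the AND of two approximate counting problems: both are yes-instances. -/
def AndApxCountYes {N : ℕ} (w : ℕ) (A : Bool → Finset (Fin N)) : Prop :=
  ∀ b, ApxCountYes w (A b)

/-- No-instances of the AND of two approximate counting problems: both sets satisfy the
approximate counting promise and at least one of them is a no-instance. -/
def AndApxCountNo {N : ℕ} (w : ℕ) (A : Bool → Finset (Fin N)) : Prop :=
  (∀ b, ApxCountYes w (A b) ∨ ApxCountNo w (A b)) ∧ ∃ b, ApxCountNo w (A b)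

/-- `Q` is an SBQP algorithm for the AND of two approximate counting problems: for some
threshold `α > 0` it accepts every yes-instance with probability at least `2α` and every
no-instance with probability at most `α`. -/
def IsSBQPForAndApxCount {N T : ℕ} {W : Type*} [Fintype W] [DecidableEq W]
    (Q : QueryAlgorithm N T W) (w : ℕ) : Prop :=
  ∃ α : ℝ, 0 < α ∧
    (∀ A : Bool → Finset (Fin N), AndApxCountYes w A → 2 * α ≤ Q.acceptProb A) ∧
    (∀ A : Bool → Finset (Fin N), AndApxCountNo w A → Q.acceptProb A ≤ α)

end QuantumQuery

open Polynomial

namespace QuantumQuery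

/-! Polynomial method on a hyperbola. Averaged over oracles of sizes `a`, `b`, the acceptance
probability is a polynomial `F(a, b)` of degree at most `2T` in each variable
(`exists_symmetrization`). It lies in `[0, α]` at integer points of `[0, w] × [2w, N]` and of its
mirror image; if `T ≪ √w`, Markov's inequality bounds it on the full rectangles
(`abs_le_of_forall_nat_of_forall_nat`). Off the promise no bound of order `α` is available, so `F`
is followed along `(2wt, 2w/t)`, which lies in a rectangle for `2 ≤ t ≤ N/(2w)` and meets a
yes-instance at `t = 1`. Adding the `t ↔ 1/t` reflection gives a polynomial in `s = t + 1/t`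
(`exists_polynomial_add_inv`). It is `O(α)` on `[5/2, N/(2w)]` but visibly larger at `s = 2`.
Chebyshev growth allows only a factor `exp(O(T²w/N))` (`abs_eval_le_mul_exp`), forcing `T² =
Ω(N/w)`. -/

/-! ### Chebyshev growth and Markov's inequality. -/

theorem one_add_sq_div_two_le_cosh (x : ℝ) : 1 + x ^ 2 / 2 ≤ Real.cosh x := by
  have h1 : Real.cosh x = 1 + 2 * Real.sinh (x / 2) ^ 2 := by
    have := Real.cosh_two_mul (x / 2)
    rw [mul_div_cancel₀ x two_ne_zero, Real.cosh_sq] at this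
    linarith
  have h2 : (x / 2) ^ 2 ≤ Real.sinh (x / 2) ^ 2 := by
    rw [sq_le_sq, Real.abs_sinh]
    exact Real.self_le_sinh_iff.2 (abs_nonneg _)
  nlinarith

theorem iterate_derivative_comp_linear (P : ℝ[X]) (r m : ℝ) (k : ℕ) :
    derivative^[k] (P.comp (C r * X + C m)) =
      C (r ^ k) * (derivative^[k] P).comp (C r * X + C m) := by
  induction k with
  | zero => simp
  | succ k ih =>
    rw [Function.iterate_succ_apply', ih, Function.iterate_succ_apply', derivative_C_mul,
      derivative_comp, pow_succ, C_mul]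
    simp only [derivative_add, derivative_C_mul, derivative_X, derivative_C]
    ring

/-- With `x = cosh θ`, `T_n(x) = cosh nθ ≤ exp(n²θ²/2)`, and `θ²/2 ≤ x - 1`. -/
theorem eval_T_le_exp (n : ℕ) {x : ℝ} (hx : 1 ≤ x) :
    (Chebyshev.T ℝ n).eval x ≤ Real.exp ((n : ℝ) ^ 2 * (x - 1)) := by
  obtain ⟨θ, rfl⟩ : ∃ θ, Real.cosh θ = x := ⟨Real.arcosh x, Real.cosh_arcosh hx⟩
  have h := Chebyshev.T_real_cosh θ n
  rw [h]
  refine (Real.cosh_le_exp_half_sq _).trans (Real.exp_le_exp.2 ?_)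
  have h1 : 1 + θ ^ 2 / 2 ≤ Real.cosh θ := one_add_sq_div_two_le_cosh θ
  push_cast
  nlinarith [sq_nonneg (n : ℝ)]

/-- Extremality of Chebyshev polynomials, transported to the interval with centre `m` and
(signed) radius `r`. -/
theorem abs_iterate_derivative_eval_le {P : ℝ[X]} {d : ℕ} (hd : P.natDegree ≤ d) {B m r : ℝ}
    (hB : 0 < B) (hP : ∀ s ∈ Set.Icc (-1 : ℝ) 1, |P.eval (m + r * s)| ≤ B) (k : ℕ) {x : ℝ}
    (hx : 1 ≤ x) :
    |r| ^ k * |(derivative^[k] P).eval (m + r * x)| ≤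
      B * (derivative^[k] (Chebyshev.T ℝ d)).eval x := by
  have key : ∀ c : ℝ, |c| = B⁻¹ → c * (r ^ k * (derivative^[k] P).eval (m + r * x)) ≤
      (derivative^[k] (Chebyshev.T ℝ d)).eval x := by
    intro c hc
    have := Chebyshev.eval_iterate_derivative_le_of_forall_abs_le_one (n := d) (k := k)
      (P := C c * P.comp (C r * X + C m)) hx ?_ ?_
    · rw [iterate_derivative_C_mul, iterate_derivative_comp_linear] at this
      simpa [add_comm] using this
    · refine degree_le_of_natDegree_le ((natDegree_C_mul_le _ _).trans ?_)
      refine natDegree_comp_le.trans ?_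
      calc _ ≤ d * 1 := Nat.mul_le_mul hd natDegree_linear_le
        _ = d := mul_one d
    · intro s hs
      have := hP s hs
      simp only [eval_mul, eval_C, eval_comp, eval_add, eval_X, abs_mul, hc]
      rw [add_comm, inv_mul_le_iff₀ hB, mul_one]
      exact this
  rw [← abs_pow, ← abs_mul, abs_le']
  have h1 := key B⁻¹ (abs_of_pos (inv_pos.2 hB))
  have h2 := key (-B⁻¹) (by rw [abs_neg, abs_of_pos (inv_pos.2 hB)])
  rw [inv_mul_le_iff₀ hB] at h1
  rw [neg_mul, ← mul_neg, inv_mul_le_iff₀ hB] at h2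
  exact ⟨h1, h2⟩

/-- A polynomial bounded on `[a, b]` grows slowly to the left of `a`. -/
theorem abs_eval_le_mul_exp {P : ℝ[X]} {d : ℕ} (hd : P.natDegree ≤ d) {B a b x : ℝ}
    (hB : 0 < B) (hab : a < b) (hP : ∀ s ∈ Set.Icc a b, |P.eval s| ≤ B) (hx : x ≤ a) :
    |P.eval x| ≤ B * Real.exp ((d : ℝ) ^ 2 * (2 * (a - x) / (b - a))) := by
  have hba : 0 < b - a := sub_pos.2 hab
  have hy : (1 : ℝ) ≤ 1 + 2 * (a - x) / (b - a) := by
    have : 0 ≤ 2 * (a - x) / (b - a) := by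
      apply div_nonneg <;> linarith
    linarith
  -- The negative radius reverses the interval, so points left of `a` correspond to arguments at
  -- least `1`.
  have h := abs_iterate_derivative_eval_le (m := (a + b) / 2) (r := (a - b) / 2) hd hB ?_ 0 hy
  · have hx' : (a + b) / 2 + (a - b) / 2 * (1 + 2 * (a - x) / (b - a)) = x := by
      field_simp; ring
    simp only [pow_zero, one_mul, Function.iterate_zero, id, hx'] at h
    refine h.trans (mul_le_mul_of_nonneg_left ?_ hB.le)
    refine (eval_T_le_exp d hy).trans_eq ?_
    congr 2; ring
  · rintro s ⟨h1, h2⟩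
    exact hP _ ⟨by nlinarith, by nlinarith⟩

/-- A weak form of the Markov brothers' inequality. -/
theorem abs_derivative_eval_le {P : ℝ[X]} {d : ℕ} (hd : P.natDegree ≤ d) {B a b x : ℝ}
    (hB : 0 < B) (hab : a < b) (hP : ∀ s ∈ Set.Icc a b, |P.eval s| ≤ B)
    (hx : x ∈ Set.Icc a b) :
    |(derivative P).eval x| ≤ 4 * (d : ℝ) ^ 2 / (b - a) * B := by
  -- Extremality applies only from the endpoint `1` on, so `x` is made an endpoint of a subinterval
  -- reaching to the farther of `a`, `b`; it has length at least `(b - a) / 2`.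
  have key : ∀ r : ℝ, (b - a) / 4 ≤ |r| → (∀ s ∈ Set.Icc (-1 : ℝ) 1, x - r + r * s ∈ Set.Icc a b) →
      |(derivative P).eval x| ≤ 4 * (d : ℝ) ^ 2 / (b - a) * B := by
    intro r hr hs
    have h := abs_iterate_derivative_eval_le (m := x - r) (r := r) hd hB
      (fun s h => hP _ (hs s h)) 1 le_rfl
    simp only [pow_one, mul_one, sub_add_cancel, Function.iterate_one,
      Chebyshev.derivative_T_eval_one] at h
    push_cast at h
    have h3 := (mul_le_mul_of_nonneg_right hr (abs_nonneg ((derivative P).eval x))).trans h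
    have hba : 0 < b - a := sub_pos.2 hab
    rw [div_mul_eq_mul_div, le_div_iff₀ hba]
    linarith
  obtain ⟨h1, h2⟩ := hx
  rcases le_total x ((a + b) / 2) with h | h
  · refine key ((x - b) / 2) ?_ ?_
    · rw [abs_of_nonpos] <;> linarith
    · rintro s ⟨h3, h4⟩
      exact ⟨by nlinarith, by nlinarith⟩
  · refine key ((x - a) / 2) ?_ ?_
    · rw [abs_of_nonneg] <;> linarith
    · rintro s ⟨h3, h4⟩
      exact ⟨by nlinarith, by nlinarith⟩

/-! ### From integer points to intervals. -/

/-- A polynomial of degree at most `√(n / 10)` that is bounded at the integers of an interval of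
length `n` is bounded on the whole interval. -/
theorem abs_eval_le_of_forall_nat {P : ℝ[X]} {d : ℕ} (hd : P.natDegree ≤ d) {B : ℝ} {m n : ℕ}
    (hn : 0 < n) (hdn : 10 * d ^ 2 ≤ n)
    (hP : ∀ i : ℕ, m ≤ i → i ≤ m + n → |P.eval (i : ℝ)| ≤ B) {x : ℝ}
    (hx : x ∈ Set.Icc (m : ℝ) (m + n)) : |P.eval x| ≤ 5 / 4 * B := by
  have hn' : (0 : ℝ) < n := by exact_mod_cast hn
  obtain ⟨y, hy, hmax⟩ := isCompact_Icc.exists_isMaxOn (⟨x, hx⟩ : (Set.Icc (m : ℝ) (m + n)).Nonempty)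
    (f := fun t => |P.eval t|) (by fun_prop)
  set M := |P.eval y| with hM
  have hbd : ∀ s ∈ Set.Icc (m : ℝ) (m + n), |P.eval s| ≤ M := fun s hs => hmax hs
  have hxM := hbd x hx
  have hM0 : 0 ≤ M := abs_nonneg _
  obtain ⟨i, hi1, hi2, hi⟩ : ∃ i : ℕ, m ≤ i ∧ i ≤ m + n ∧ |y - i| ≤ 1 / 2 := by
    have h0 : 0 ≤ y := (Nat.cast_nonneg m).trans hy.1
    have h1 : 0 ≤ y + 1 / 2 := by linarith
    refine ⟨⌊y + 1 / 2⌋₊, ?_, ?_, ?_⟩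
    · exact Nat.le_floor (by linarith [hy.1])
    · refine Nat.le_of_lt_succ ((Nat.floor_lt h1).2 ?_)
      push_cast; linarith [hy.2]
    · have h2 := Nat.floor_le h1
      have h3 := Nat.lt_floor_add_one (y + 1 / 2)
      rw [abs_le]; constructor <;> linarith
  have hB := hP i hi1 hi2
  rcases hM0.eq_or_lt with h0 | h0
  · have : 0 ≤ B := (abs_nonneg _).trans hB
    rw [← h0] at hxM; linarith
  -- Markov gives slope at most `4d²/n · M ≤ 2M/5`. An integer lies within `1/2` of the maximum
  -- point, so `M ≤ B + M/5`.
  have hder : ∀ s ∈ Set.Icc (m : ℝ) (m + n), ‖deriv (fun t => P.eval t) s‖ ≤ 2 / 5 * M := by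
    intro s hs
    rw [Polynomial.deriv, Real.norm_eq_abs]
    refine (abs_derivative_eval_le hd h0 (by linarith) hbd hs).trans ?_
    refine mul_le_mul_of_nonneg_right ?_ hM0
    rw [add_sub_cancel_left, div_le_iff₀ hn']
    have : (10 * d ^ 2 : ℝ) ≤ n := by exact_mod_cast hdn
    linarith
  have hmv := (convex_Icc (m : ℝ) (m + n)).norm_image_sub_le_of_norm_deriv_le
    (fun s _ => P.differentiable.differentiableAt) hder
    (⟨by exact_mod_cast hi1, by exact_mod_cast hi2⟩ : (i : ℝ) ∈ Set.Icc (m : ℝ) (m + n)) hy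
  simp only [Real.norm_eq_abs] at hmv
  have h5 : |P.eval y| - |P.eval (i : ℝ)| ≤ |P.eval y - P.eval (i : ℝ)| := abs_sub_abs_le_abs_sub _ _
  have h6 : 2 / 5 * M * |y - i| ≤ 2 / 5 * M * (1 / 2) := by gcongr
  linarith

/-- The two-variable version of `abs_eval_le_of_forall_nat`. -/
theorem abs_le_of_forall_nat_of_forall_nat {F : ℝ → ℝ → ℝ} {d : ℕ}
    (hF₁ : ∀ y, ∃ P : ℝ[X], P.natDegree ≤ d ∧ ∀ x, P.eval x = F x y)
    (hF₂ : ∀ x, ∃ P : ℝ[X], P.natDegree ≤ d ∧ ∀ y, P.eval y = F x y)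
    {B : ℝ} {m₁ n₁ m₂ n₂ : ℕ} (hn₁ : 0 < n₁) (hn₂ : 0 < n₂) (hd₁ : 10 * d ^ 2 ≤ n₁)
    (hd₂ : 10 * d ^ 2 ≤ n₂)
    (hB : ∀ i j : ℕ, m₁ ≤ i → i ≤ m₁ + n₁ → m₂ ≤ j → j ≤ m₂ + n₂ → |F i j| ≤ B) {x y : ℝ}
    (hx : x ∈ Set.Icc (m₁ : ℝ) (m₁ + n₁)) (hy : y ∈ Set.Icc (m₂ : ℝ) (m₂ + n₂)) :
    |F x y| ≤ 25 / 16 * B := by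
  obtain ⟨P, hP, hPF⟩ := hF₂ x
  rw [← hPF]
  refine (abs_eval_le_of_forall_nat hP hn₂ hd₂ (B := 5 / 4 * B) ?_ hy).trans_eq (by ring)
  intro j hj1 hj2
  obtain ⟨R, hR, hRF⟩ := hF₁ j
  rw [hPF, ← hRF]
  refine abs_eval_le_of_forall_nat hR hn₁ hd₁ ?_ hx
  intro i hi1 hi2
  rw [hRF]
  exact hB i j hi1 hi2 hj1 hj2

/-! ### Symmetric Laurent polynomials. -/

/-- If `u`, `v` are polynomials, then `u (c t) v (c / t) + u (c / t) v (c t)` is a polynomial in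
`t + 1 / t`. -/
theorem exists_polynomial_add_inv {u v : ℝ[X]} {d : ℕ} (hu : u.natDegree ≤ d)
    (hv : v.natDegree ≤ d) (c : ℝ) :
    ∃ q : ℝ[X], q.natDegree ≤ d ∧ ∀ t : ℝ, t ≠ 0 → q.eval (t + t⁻¹) =
      u.eval (c * t) * v.eval (c * t⁻¹) + u.eval (c * t⁻¹) * v.eval (c * t) := by
  have hdick : ∀ n, (dickson 1 (1 : ℝ) n).natDegree ≤ n := by
    intro n
    induction n using Nat.strong_induction_on with
    | _ n ih =>
      match n with
      | 0 => rw [dickson_zero]; norm_num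
      | 1 => simp
      | n + 2 =>
        rw [dickson_add_two]
        refine (natDegree_sub_le _ _).trans (max_le ?_ ?_)
        · refine natDegree_mul_le.trans ?_
          have := ih (n + 1) (by omega)
          rw [natDegree_X]; omega
        · refine (natDegree_C_mul_le _ _).trans ?_
          have := ih n (by omega)
          omega
  -- With `k = |i - j|` the sum is `t^k + t^(-k)`, a Dickson polynomial in `t + 1/t`; hence degree
  -- `d` and not `2d`.
  have hmon : ∀ i j : ℕ, ∃ q : ℝ[X], (i ≤ d → j ≤ d → q.natDegree ≤ d) ∧ ∀ t : ℝ, t ≠ 0 →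
      q.eval (t + t⁻¹) = t ^ i * t⁻¹ ^ j + t⁻¹ ^ i * t ^ j := by
    intro i j
    wlog hij : i ≤ j generalizing i j
    · obtain ⟨q, hq, hqe⟩ := this j i (by omega)
      exact ⟨q, fun h1 h2 => hq h2 h1, fun t ht => by rw [hqe t ht]; ring⟩
    obtain ⟨k, rfl⟩ := Nat.exists_eq_add_of_le hij
    refine ⟨dickson 1 1 k, fun _ h => (hdick k).trans (by omega), fun t ht => ?_⟩
    rw [dickson_one_one_eval_add_inv t t⁻¹ (mul_inv_cancel₀ ht), pow_add, pow_add]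
    have : t ^ i * t⁻¹ ^ i = 1 := by rw [← mul_pow, mul_inv_cancel₀ ht, one_pow]
    linear_combination (-(t ^ k + t⁻¹ ^ k)) * this
  choose q hq hqe using hmon
  refine ⟨∑ i ∈ Finset.range (d + 1), ∑ j ∈ Finset.range (d + 1),
    C (u.coeff i * v.coeff j * c ^ (i + j)) * q i j, ?_, fun t ht => ?_⟩
  · refine natDegree_sum_le_of_forall_le _ _ fun i hi => natDegree_sum_le_of_forall_le _ _ fun j hj => ?_
    rw [Finset.mem_range] at hi hj
    exact (natDegree_C_mul_le _ _).trans (hq i j (by omega) (by omega))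
  · simp only [eval_finsetSum, eval_mul, eval_C, hqe _ _ t ht,
      eval_eq_sum_range' (Nat.lt_succ_of_le hu), eval_eq_sum_range' (Nat.lt_succ_of_le hv),
      Finset.sum_mul_sum, ← Finset.sum_add_distrib]
    refine Finset.sum_congr rfl fun i _ => Finset.sum_congr rfl fun j _ => ?_
    ring

/-! ### Acceptance probabilities as polynomials. -/

/-- The indicator vector of a pair of oracles. -/
noncomputable def oracleIndicator {N : ℕ} (A : Bool → Finset (Fin N)) (p : Bool × Fin N) : ℝ :=
  if p.2 ∈ A p.1 then 1 else 0

/-- A complex valued function of the oracles is a polynomial of degree at most `d` in the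
indicator variables. -/
def IsOraclePolynomial {N : ℕ} (d : ℕ) (f : (Bool → Finset (Fin N)) → ℂ) : Prop :=
  ∃ P R : MvPolynomial (Bool × Fin N) ℝ, P.totalDegree ≤ d ∧ R.totalDegree ≤ d ∧
    ∀ A, f A = (P.eval (oracleIndicator A) : ℝ) + (R.eval (oracleIndicator A) : ℝ) * Complex.I

namespace IsOraclePolynomial

variable {N d : ℕ}

theorem const (c : ℂ) : IsOraclePolynomial (N := N) d fun _ => c :=
  ⟨MvPolynomial.C c.re, MvPolynomial.C c.im, by simp, by simp, fun A => by simp⟩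

theorem const_mul {f : (Bool → Finset (Fin N)) → ℂ} (c : ℂ) (hf : IsOraclePolynomial d f) :
    IsOraclePolynomial d fun A => c * f A := by
  obtain ⟨P, R, hP, hR, h⟩ := hf
  have hC : ∀ (r : ℝ) (Q : MvPolynomial (Bool × Fin N) ℝ), Q.totalDegree ≤ d →
      (MvPolynomial.C r * Q).totalDegree ≤ d := fun r Q hQ =>
    (MvPolynomial.totalDegree_mul _ _).trans (by rw [MvPolynomial.totalDegree_C]; omega)
  refine ⟨MvPolynomial.C c.re * P - MvPolynomial.C c.im * R,
    MvPolynomial.C c.re * R + MvPolynomial.C c.im * P,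
    (MvPolynomial.totalDegree_sub _ _).trans (max_le (hC _ _ hP) (hC _ _ hR)),
    (MvPolynomial.totalDegree_add _ _).trans (max_le (hC _ _ hR) (hC _ _ hP)), fun A => ?_⟩
  beta_reduce
  rw [h A]
  apply Complex.ext <;> simp

theorem sum {ι : Type*} (s : Finset ι) {f : ι → (Bool → Finset (Fin N)) → ℂ}
    (hf : ∀ i ∈ s, IsOraclePolynomial d (f i)) : IsOraclePolynomial d fun A => ∑ i ∈ s, f i A := by
  classical
  induction s using Finset.induction_on with
  | empty => simpa using const (N := N) (d := d) 0
  | insert a s ha ih =>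
    obtain ⟨P, R, hP, hR, h⟩ := hf a (Finset.mem_insert_self _ _)
    obtain ⟨P', R', hP', hR', h'⟩ := ih fun i hi => hf i (Finset.mem_insert_of_mem hi)
    refine ⟨P + P', R + R', (MvPolynomial.totalDegree_add _ _).trans (max_le hP hP'),
      (MvPolynomial.totalDegree_add _ _).trans (max_le hR hR'), fun A => ?_⟩
    beta_reduce at h' ⊢
    rw [Finset.sum_insert ha, h, h']
    simp only [map_add]
    push_cast
    ring

/-- Interpolation `g + X (f - g)` in the queried bit: this is why each query costs one degree. -/
theorem ite_mem {f g : (Bool → Finset (Fin N)) → ℂ} (hf : IsOraclePolynomial d f)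
    (hg : IsOraclePolynomial d g) (b : Bool) (i : Fin N) :
    IsOraclePolynomial (d + 1) fun A => if i ∈ A b then f A else g A := by
  obtain ⟨P, R, hP, hR, h⟩ := hf
  obtain ⟨P', R', hP', hR', h'⟩ := hg
  have key : ∀ S S' : MvPolynomial (Bool × Fin N) ℝ, S.totalDegree ≤ d → S'.totalDegree ≤ d →
      (S' + MvPolynomial.X (b, i) * (S - S')).totalDegree ≤ d + 1 := by
    intro S S' hS hS'
    refine (MvPolynomial.totalDegree_add _ _).trans (max_le (by omega) ?_)
    refine (MvPolynomial.totalDegree_mul _ _).trans ?_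
    rw [MvPolynomial.totalDegree_X]
    have := (MvPolynomial.totalDegree_sub S S').trans (max_le hS hS')
    omega
  refine ⟨_, _, key P P' hP hP', key R R' hR hR', fun A => ?_⟩
  by_cases hi : i ∈ A b <;> simp [oracleIndicator, hi, h, h']

end IsOraclePolynomial

/-- The amplitudes after `n` queries are polynomials of degree at most `n`. -/
theorem isOraclePolynomial_foldl {N : ℕ} {W : Type*} [Fintype W] (ψ : BasisState N W → ℂ) (n : ℕ)
    (U : Fin n → Matrix (BasisState N W) (BasisState N W) ℂ) (x : BasisState N W) :
    IsOraclePolynomial n fun A =>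
      Fin.foldl n (fun φ t => Matrix.mulVec (U t) (applyQuery A φ)) ψ x := by
  induction n generalizing x with
  | zero => simpa using IsOraclePolynomial.const (ψ x)
  | succ n ih =>
    simp only [Fin.foldl_succ_last, Matrix.mulVec, dotProduct]
    refine IsOraclePolynomial.sum _ fun y _ => IsOraclePolynomial.const_mul _ ?_
    obtain ⟨⟨b, i⟩, z, s⟩ := y
    convert (ih (fun t => U t.castSucc) ((b, i), !z, s)).ite_mem
      (ih (fun t => U t.castSucc) ((b, i), z, s)) b i using 2 with A
    by_cases hi : i ∈ A b <;> simp [applyQuery, queryMap, hi]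

/-- The acceptance probability of a `T`-query algorithm is a polynomial of degree at most `2T`. -/
theorem exists_mvPolynomial_acceptProb {N T : ℕ} {W : Type*} [Fintype W] [DecidableEq W]
    (Q : QueryAlgorithm N T W) : ∃ P : MvPolynomial (Bool × Fin N) ℝ, P.totalDegree ≤ 2 * T ∧
      ∀ A, P.eval (oracleIndicator A) = Q.acceptProb A := by
  choose P R hP hR h using isOraclePolynomial_foldl Q.start T fun t => Q.unitary t
  refine ⟨∑ x ∈ Q.accept, (P x ^ 2 + R x ^ 2), ?_, fun A => ?_⟩
  · refine MvPolynomial.totalDegree_finsetSum_le fun x _ => ?_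
    refine (MvPolynomial.totalDegree_add _ _).trans (max_le ?_ ?_)
    · exact (MvPolynomial.totalDegree_pow _ _).trans (Nat.mul_le_mul_left 2 (hP x))
    · exact (MvPolynomial.totalDegree_pow _ _).trans (Nat.mul_le_mul_left 2 (hR x))
  · rw [map_sum, QueryAlgorithm.acceptProb]
    refine Finset.sum_congr rfl fun x _ => ?_
    have hx : Q.finalState A x = _ := h x A
    rw [hx, ← Complex.normSq_eq_norm_sq, Complex.normSq_add_mul_I]
    simp

/-! ### Averaging over oracles of given sizes. -/

theorem card_filter_subset_powersetCard {α : Type*} [Fintype α] [DecidableEq α] (S : Finset α)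
    (a : ℕ) (h : S.card ≤ a) : ((Finset.powersetCard a Finset.univ).filter (S ⊆ ·)).card =
      (Fintype.card α - S.card).choose (a - S.card) := by
  rw [← Finset.card_compl, ← Finset.card_powersetCard]
  refine Finset.card_nbij' (· \ S) (· ∪ S) ?_ ?_ ?_ ?_
  · intro A hA
    simp only [Finset.coe_filter, Finset.mem_powersetCard, Set.mem_ofPred_eq] at hA
    simp only [Finset.mem_coe, Finset.mem_powersetCard]
    exact ⟨fun i hi => by simp_all, by rw [Finset.card_sdiff_of_subset hA.2, hA.1.2]⟩
  · intro B hB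
    simp only [Finset.mem_coe, Finset.mem_powersetCard] at hB
    simp only [Finset.coe_filter, Finset.mem_powersetCard, Set.mem_ofPred_eq]
    refine ⟨⟨Finset.subset_univ _, ?_⟩, Finset.subset_union_right⟩
    rw [Finset.card_union_of_disjoint, hB.2]
    · omega
    · exact Finset.disjoint_left.2 fun i hi => Finset.mem_compl.1 (hB.1 hi)
  · intro A hA
    simp only [Finset.coe_filter, Set.mem_ofPred_eq] at hA
    exact Finset.sdiff_union_of_subset hA.2
  · intro B hB
    simp only [Finset.mem_coe, Finset.mem_powersetCard] at hB
    refine Finset.union_sdiff_cancel_right ?_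
    exact Finset.disjoint_left.2 fun i hi => Finset.mem_compl.1 (hB.1 hi)

/-- The probability that a random set of size `a` contains `S` is a polynomial in `a`. -/
theorem exists_polynomial_sum_subset {N : ℕ} (S : Finset (Fin N)) :
    ∃ u : ℝ[X], u.natDegree ≤ S.card ∧ ∀ a : ℕ,
      ∑ A ∈ Finset.powersetCard a Finset.univ, (if S ⊆ A then 1 else 0 : ℝ) =
        N.choose a * u.eval (a : ℝ) := by
  have hSN : S.card ≤ N := by simpa using Finset.card_le_univ S
  have hpos : (0 : ℝ) < N.choose S.card := by exact_mod_cast Nat.choose_pos hSN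
  have hfac : (0 : ℝ) < S.card.factorial := by exact_mod_cast Nat.factorial_pos _
  -- For `k = |S|` the probability is the ratio of falling factorials `(a)_k / (N)_k`, which also
  -- vanishes when `a < k`.
  refine ⟨C ((N.choose S.card * S.card.factorial : ℝ)⁻¹) * descPochhammer ℝ S.card,
    (natDegree_C_mul_le _ _).trans (descPochhammer_natDegree ℝ _).le, fun a => ?_⟩
  rw [eval_mul, eval_C, descPochhammer_eval_eq_descFactorial,
    Nat.descFactorial_eq_factorial_mul_choose, Finset.sum_boole]
  push_cast
  rcases le_or_gt S.card a with h | h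
  · rw [card_filter_subset_powersetCard S a h, Fintype.card_fin]
    have := congrArg (Nat.cast : ℕ → ℝ) (Nat.choose_mul (n := N) h)
    push_cast at this
    field_simp
    linarith
  · rw [Nat.choose_eq_zero_of_lt h, Finset.filter_eq_empty_iff.2]
    · simp
    · intro A hA hSA
      have := Finset.card_le_card hSA
      rw [(Finset.mem_powersetCard.1 hA).2] at this
      omega

/-- Indicators are idempotent, so exponents are irrelevant and a monomial splits into one
containment event per oracle. -/
theorem prod_oracleIndicator_pow {N : ℕ} (A : Bool → Finset (Fin N)) (m : Bool × Fin N →₀ ℕ) :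
    ∏ p ∈ m.support, oracleIndicator A p ^ m p =
      ∏ b, if Finset.univ.filter (fun i => m (b, i) ≠ 0) ⊆ A b then (1 : ℝ) else 0 := by
  by_cases h : ∀ b, Finset.univ.filter (fun i => m (b, i) ≠ 0) ⊆ A b
  · rw [Finset.prod_eq_one, Finset.prod_eq_one]
    · exact fun b _ => if_pos (h b)
    · rintro ⟨b, i⟩ hp
      have : i ∈ A b := h b (by simpa using hp)
      simp [oracleIndicator, this]
  · push Not at h
    obtain ⟨b, hb⟩ := h
    rw [Finset.prod_eq_zero (Finset.mem_univ b) (if_neg hb)]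
    obtain ⟨i, hi, hiA⟩ := Finset.not_subset.1 hb
    have hi' : m (b, i) ≠ 0 := by simpa using hi
    refine Finset.prod_eq_zero (i := (b, i)) (by simpa using hi') ?_
    simp [oracleIndicator, hiA, hi']

/-- Symmetrization: averaged over the oracles of given sizes `a`, `b`, the acceptance probability
is a polynomial in `a` and `b`. -/
theorem exists_symmetrization {N T : ℕ} {W : Type*} [Fintype W] [DecidableEq W]
    (Q : QueryAlgorithm N T W) :
    ∃ (S : Finset (Bool × Fin N →₀ ℕ)) (u v : (Bool × Fin N →₀ ℕ) → ℝ[X]),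
      (∀ m ∈ S, (u m).natDegree ≤ 2 * T) ∧ (∀ m ∈ S, (v m).natDegree ≤ 2 * T) ∧
      ∀ a b : ℕ,
        ∑ A ∈ Finset.powersetCard a Finset.univ, ∑ B ∈ Finset.powersetCard b Finset.univ,
          Q.acceptProb (fun c => cond c B A) =
        N.choose a * N.choose b * ∑ m ∈ S, (u m).eval (a : ℝ) * (v m).eval (b : ℝ) := by
  obtain ⟨P, hP, hPQ⟩ := exists_mvPolynomial_acceptProb Q
  choose u hu hsum using exists_polynomial_sum_subset (N := N)
  let K (m : Bool × Fin N →₀ ℕ) (b : Bool) : Finset (Fin N) :=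
    Finset.univ.filter fun i => m (b, i) ≠ 0
  have hK : ∀ m ∈ P.support, ∀ b, (K m b).card ≤ 2 * T := by
    intro m hm b
    refine le_trans ?_ ((MvPolynomial.le_totalDegree hm).trans hP)
    have h1 : (K m b).card ≤ m.support.card :=
      Finset.card_le_card_of_injOn (fun i => (b, i)) (fun i hi => by simpa [K] using hi)
        (fun i _ j _ hij => by simpa using hij)
    refine h1.trans ?_
    rw [Finset.card_eq_sum_ones]
    exact Finset.sum_le_sum fun p hp => Nat.one_le_iff_ne_zero.2 (Finsupp.mem_support_iff.1 hp)
  refine ⟨P.support, fun m => C (P.coeff m) * u (K m false), fun m => u (K m true),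
    fun m hm => (natDegree_C_mul_le _ _).trans ((hu _).trans (hK m hm _)),
    fun m hm => (hu _).trans (hK m hm _), fun a b => ?_⟩
  have h1 : ∀ A B : Finset (Fin N), Q.acceptProb (fun c => cond c B A) = ∑ m ∈ P.support,
      P.coeff m * ((if K m false ⊆ A then 1 else 0) * (if K m true ⊆ B then 1 else 0)) := by
    intro A B
    rw [← hPQ, MvPolynomial.eval_eq]
    refine Finset.sum_congr rfl fun m _ => ?_
    rw [prod_oracleIndicator_pow, Fintype.prod_bool, mul_comm (ite _ _ _)]
    rfl
  simp only [h1]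
  rw [Finset.sum_congr rfl fun A _ => Finset.sum_comm, Finset.sum_comm, Finset.mul_sum]
  refine Finset.sum_congr rfl fun m _ => ?_
  simp only [← Finset.mul_sum, ← Finset.sum_mul, hsum]
  rw [eval_mul, eval_C]
  ring

/-- A bound on the acceptance probability for all oracles of given sizes carries over to its
average. -/
theorem symmetrization_mem_Icc {N T : ℕ} {W : Type*} [Fintype W] [DecidableEq W]
    {Q : QueryAlgorithm N T W} {a b : ℕ} (ha : a ≤ N) (hb : b ≤ N) {s : ℝ}
    (hs : ∑ A ∈ Finset.powersetCard a Finset.univ, ∑ B ∈ Finset.powersetCard b Finset.univ,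
      Q.acceptProb (fun c => cond c B A) = N.choose a * N.choose b * s) (lo hi : ℝ) :
    ((∀ A : Bool → Finset (Fin N), (A false).card = a → (A true).card = b →
      lo ≤ Q.acceptProb A) → lo ≤ s) ∧
    ((∀ A : Bool → Finset (Fin N), (A false).card = a → (A true).card = b →
      Q.acceptProb A ≤ hi) → s ≤ hi) := by
  have hpos : (0 : ℝ) < N.choose a * N.choose b := by
    exact_mod_cast Nat.mul_pos (Nat.choose_pos ha) (Nat.choose_pos hb)
  have hconst : ∀ r : ℝ, ∑ _A ∈ Finset.powersetCard a (Finset.univ : Finset (Fin N)),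
      ∑ _B ∈ Finset.powersetCard b (Finset.univ : Finset (Fin N)), r =
        N.choose a * N.choose b * r := by
    intro r
    simp [Finset.card_powersetCard, mul_assoc]
  refine ⟨fun h => ?_, fun h => ?_⟩ <;>
  · refine le_of_mul_le_mul_left ?_ hpos
    rw [← hs, ← hconst]
    exact Finset.sum_le_sum fun A hA => Finset.sum_le_sum fun B hB =>
      h _ (Finset.mem_powersetCard.1 hA).2 (Finset.mem_powersetCard.1 hB).2

/-! ### The hyperbola argument. -/

/-- An algorithm for the AND of two approximate counting problems makes at least one query. -/
theorem IsSBQPForAndApxCount.pos {N w T : ℕ} {W : Type*} [Fintype W] [DecidableEq W]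
    {Q : QueryAlgorithm N T W} (hwN : 2 * w ≤ N) (hQ : IsSBQPForAndApxCount Q w) : 0 < T := by
  obtain ⟨α, hα, hyes, hno⟩ := hQ
  rcases T.eq_zero_or_pos with rfl | h
  · have h1 := hyes (fun _ => Finset.univ) fun b => by simpa [ApxCountYes] using hwN
    have h2 := hno (fun _ => ∅) ⟨fun b => Or.inr (by simp [ApxCountNo]), true, by simp [ApxCountNo]⟩
    simp only [QueryAlgorithm.acceptProb, QueryAlgorithm.finalState, Fin.foldl_zero] at h1 h2
    linarith
  · exact h

theorem not_isSBQPForAndApxCount {N w T : ℕ} {W : Type*} [Fintype W] [DecidableEq W]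
    (Q : QueryAlgorithm N T W) (hw : 0 < w) (hN : 100 * w ≤ N) (hT : 100 * T ^ 2 ≤ w)
    (hT' : 100 * T ^ 2 * w ≤ N) : ¬ IsSBQPForAndApxCount Q w := by
  rintro ⟨α, hα, hyes, hno⟩
  obtain ⟨S, u, v, hu, hv, hsum⟩ := exists_symmetrization Q
  set F : ℝ → ℝ → ℝ := fun x y => ∑ m ∈ S, (u m).eval x * (v m).eval y with hF
  have hmem : ∀ a b : ℕ, a ≤ N → b ≤ N → _ := fun a b ha hb =>
    symmetrization_mem_Icc (Q := Q) (s := F a b) ha hb (hsum a b)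
  have hw' : (0 : ℝ) < w := by exact_mod_cast hw
  have hNw : (100 * w : ℝ) ≤ N := by exact_mod_cast hN
  have hnonneg : ∀ A, 0 ≤ Q.acceptProb A := fun A => Finset.sum_nonneg fun x _ => sq_nonneg _
  -- Subtracting `α / 2` centres the range `[0, α]`, halving the absolute bound.
  have hF₁ : ∀ y, ∃ P : ℝ[X], P.natDegree ≤ 2 * T ∧ ∀ x, P.eval x = F x y - α / 2 := by
    refine fun y => ⟨∑ m ∈ S, C ((v m).eval y) * u m - C (α / 2), ?_, fun x => ?_⟩
    · refine (natDegree_sub_le _ _).trans (max_le ?_ (by simp))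
      exact natDegree_sum_le_of_forall_le _ _ fun m hm => (natDegree_C_mul_le _ _).trans (hu m hm)
    · simp [hF, eval_finsetSum, mul_comm]
  have hF₂ : ∀ x, ∃ P : ℝ[X], P.natDegree ≤ 2 * T ∧ ∀ y, P.eval y = F x y - α / 2 := by
    refine fun x => ⟨∑ m ∈ S, C ((u m).eval x) * v m - C (α / 2), ?_, fun y => ?_⟩
    · refine (natDegree_sub_le _ _).trans (max_le ?_ (by simp))
      exact natDegree_sum_le_of_forall_le _ _ fun m hm => (natDegree_C_mul_le _ _).trans (hv m hm)
    · simp [hF, eval_finsetSum]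
  have hno' : ∀ a b : ℕ, a ≤ N → b ≤ N → (a ≤ w ∧ 2 * w ≤ b ∨ 2 * w ≤ a ∧ b ≤ w) →
      |F a b - α / 2| ≤ α / 2 := by
    intro a b ha hb hab
    have h1 := (hmem a b ha hb 0 α).1 fun A _ _ => hnonneg A
    have h2 := (hmem a b ha hb 0 α).2 fun A hA hB => by
      refine hno A ⟨?_, ?_⟩
      · rintro (_ | _) <;> simp only [ApxCountYes, ApxCountNo, hA, hB] <;> omega
      · rcases hab with h | h
        · exact ⟨false, by simp only [ApxCountNo, hA]; omega⟩
        · exact ⟨true, by simp only [ApxCountNo, hB]; omega⟩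
    rw [abs_le]; constructor <;> linarith
  have hTw : 10 * (2 * T) ^ 2 ≤ w := by nlinarith
  have hTN : 10 * (2 * T) ^ 2 ≤ N - 2 * w := by omega
  have hcast : ((2 * w : ℕ) : ℝ) + ((N - 2 * w : ℕ) : ℝ) = N := by
    rw [← Nat.cast_add]; congr 1; omega
  have hsmall : ∀ x ∈ Set.Icc (0 : ℝ) w, ∀ y ∈ Set.Icc (2 * w : ℝ) N,
      |F x y - α / 2| ≤ 25 / 16 * (α / 2) := by
    intro x hx y hy
    refine abs_le_of_forall_nat_of_forall_nat (F := fun x y => F x y - α / 2) (m₁ := 0) (n₁ := w)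
      (m₂ := 2 * w) (n₂ := N - 2 * w) hF₁ hF₂ hw (by omega) hTw hTN ?_ (by simpa using hx) ?_
    · exact fun i j _ hi hj hj' => hno' i j (by omega) (by omega) (by omega)
    · rw [hcast]; simpa using hy
  have hlarge : ∀ x ∈ Set.Icc (2 * w : ℝ) N, ∀ y ∈ Set.Icc (0 : ℝ) w,
      |F x y - α / 2| ≤ 25 / 16 * (α / 2) := by
    intro x hx y hy
    refine abs_le_of_forall_nat_of_forall_nat (F := fun x y => F x y - α / 2) (m₁ := 2 * w)
      (n₁ := N - 2 * w) (m₂ := 0) (n₂ := w) hF₁ hF₂ (by omega) hw hTN hTw ?_ ?_ (by simpa using hy)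
    · exact fun i j hi hi' _ hj => hno' i j (by omega) (by omega) (by omega)
    · rw [hcast]; simpa using hx
  have hyes' : 2 * α ≤ F (2 * w) (2 * w) := by
    have := (hmem (2 * w) (2 * w) (by omega) (by omega) (2 * α) 0).1 fun A hA hB =>
      hyes A (by rintro (_ | _) <;> simp only [ApxCountYes, hA, hB, le_refl])
    push_cast at this
    exact this
  have hpoly : ∀ m : S, ∃ q : ℝ[X], q.natDegree ≤ 2 * T ∧ ∀ t : ℝ, t ≠ 0 →
      q.eval (t + t⁻¹) = (u m).eval (2 * w * t) * (v m).eval (2 * w * t⁻¹) +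
        (u m).eval (2 * w * t⁻¹) * (v m).eval (2 * w * t) :=
    fun m => exists_polynomial_add_inv (hu m m.2) (hv m m.2) _
  choose q hq hqe using hpoly
  set R : ℝ[X] := ∑ m, q m - C α with hR
  have hRd : R.natDegree ≤ 2 * T :=
    (natDegree_sub_le _ _).trans
      (max_le (natDegree_sum_le_of_forall_le _ _ fun m _ => hq m) (by simp))
  have hRe : ∀ t : ℝ, t ≠ 0 → R.eval (t + t⁻¹) =
      (F (2 * w * t) (2 * w * t⁻¹) - α / 2) + (F (2 * w * t⁻¹) (2 * w * t) - α / 2) := by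
    intro t ht
    simp only [hR, hF, eval_sub, eval_finsetSum, eval_C, hqe _ t ht, Finset.sum_add_distrib]
    rw [Finset.sum_coe_sort S fun m => (u m).eval (2 * w * t) * (v m).eval (2 * w * t⁻¹),
      Finset.sum_coe_sort S fun m => (u m).eval (2 * w * t⁻¹) * (v m).eval (2 * w * t)]
    ring
  -- At `t = 1` both terms are `F(2w, 2w) - α/2 ≥ 3α/2`.
  have hR2 : 3 * α ≤ R.eval 2 := by
    have := hRe 1 one_ne_zero
    norm_num at this
    rw [this]; linarith
  set t₀ : ℝ := N / (2 * w) with ht₀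
  have ht₀w : 2 * w * t₀ = N := by rw [ht₀]; field_simp
  have ht₀50 : 50 ≤ t₀ := by rw [ht₀, le_div_iff₀ (by linarith)]; linarith
  -- The endpoint `5/2 = 2 + 1/2` corresponds to `t = 2`, where `2w/t` drops to `w`.
  have hbd : ∀ s ∈ Set.Icc (5 / 2 : ℝ) t₀, |R.eval s| ≤ 25 / 16 * α := by
    intro s hs
    have hcont : ContinuousOn (fun t : ℝ => t + t⁻¹) (Set.Icc 2 t₀) :=
      continuousOn_id.add (continuousOn_id.inv₀ fun t ht => by
        have := ht.1; simp only [id]; linarith)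
    have hinv : 0 ≤ t₀⁻¹ := by positivity
    have hs' : s ∈ Set.Icc ((2 : ℝ) + 2⁻¹) (t₀ + t₀⁻¹) :=
      ⟨by norm_num; linarith [hs.1], by linarith [hs.2]⟩
    obtain ⟨t, ⟨ht1, ht2⟩, rfl⟩ := intermediate_value_Icc (by linarith) hcont hs'
    have ht0 : 0 < t := by linarith
    rw [hRe t ht0.ne']
    have hX : 2 * w * t ∈ Set.Icc (2 * w : ℝ) N := ⟨by nlinarith, by nlinarith⟩
    have hY : 2 * w * t⁻¹ ∈ Set.Icc (0 : ℝ) w := by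
      refine ⟨by positivity, ?_⟩
      rw [← div_eq_mul_inv, div_le_iff₀ ht0]
      nlinarith
    have h1 := hlarge _ hX _ hY
    have h2 := hsmall _ hY _ hX
    refine (abs_add_le _ _).trans ?_
    linarith
  have hext := abs_eval_le_mul_exp hRd (x := 2) (by positivity) (by linarith) hbd (by norm_num)
  -- Since `t₀ ≥ 50T²` and `t₀ ≥ 50`, also `40T² ≤ t₀ - 5/2`. The resulting bound `25/16 · 10/9 · α`
  -- is below `3α`.
  have hexp : ((2 * T : ℕ) : ℝ) ^ 2 * (2 * (5 / 2 - 2) / (t₀ - 5 / 2)) ≤ 1 / 10 := by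
    have hT2 : 100 * (T : ℝ) ^ 2 * w ≤ N := by exact_mod_cast hT'
    have hT3 : 50 * (T : ℝ) ^ 2 ≤ t₀ := by
      rw [ht₀, le_div_iff₀ (by linarith)]; linarith
    rw [← mul_div_assoc, div_le_iff₀ (by linarith)]
    push_cast
    linarith
  have h1 := Real.exp_le_exp.2 hexp
  have h2 := Real.add_one_le_exp (-(1 / 10) : ℝ)
  have h3 : Real.exp (1 / 10) * Real.exp (-(1 / 10)) = 1 := by rw [← Real.exp_add]; simp
  have h4 : Real.exp (1 / 10) ≤ 10 / 9 := by nlinarith [Real.exp_pos (1 / 10)]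
  have h5 := le_abs_self (R.eval 2)
  have h6 := mul_le_mul_of_nonneg_left (h1.trans h4) (by positivity : 0 ≤ 25 / 16 * α)
  linarith

end QuantumQuery

theorem theorem3p2 :
    ∃ c : ℝ, 0 < c ∧
      ∀ (N w T : ℕ) (W : Type*) [Fintype W] [DecidableEq W]
        (Q : QuantumQuery.QueryAlgorithm N T W),
        0 < w → 2 * w ≤ N → QuantumQuery.IsSBQPForAndApxCount Q w →
          c * min (Real.sqrt (w : ℝ)) (Real.sqrt ((N : ℝ) / (w : ℝ))) ≤ (T : ℝ) := by
  refine ⟨1 / 10, by norm_num, fun N w T W _ _ Q hw hwN hQ => ?_⟩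
  have hT : (1 : ℝ) ≤ T := by exact_mod_cast hQ.pos hwN
  have hw' : (0 : ℝ) < w := by exact_mod_cast hw
  by_contra! h
  have h1 : 10 * (T : ℝ) < Real.sqrt w := by linarith [min_le_left (√(w : ℝ)) √((N : ℝ) / w)]
  have h2 : 10 * (T : ℝ) < Real.sqrt (N / w) := by
    linarith [min_le_right (√(w : ℝ)) √((N : ℝ) / w)]
  rw [Real.lt_sqrt (by positivity)] at h1 h2
  rw [lt_div_iff₀ hw'] at h2
  refine QuantumQuery.not_isSBQPForAndApxCount Q hw ?_ ?_ ?_ hQ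
  -- Here `T ≥ 1` matters: it turns `100T²w ≤ N` into `100w ≤ N`.
  · have : (w : ℝ) ≤ (T : ℝ) ^ 2 * w := le_mul_of_one_le_left hw'.le (one_le_pow₀ hT)
    have : (100 * w : ℝ) ≤ N := by linarith
    exact_mod_cast this
  · have : (100 * T ^ 2 : ℝ) ≤ w := by linarith
    exact_mod_cast this
  · have : (100 * T ^ 2 * w : ℝ) ≤ N := by linarith
    exact_mod_cast this
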